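/- **Syntax.** Formulae over propositional variables $p$ are $A ::= p \mid \top \mid \bot \mid \top^* \mid A\land B \mid A\to B \mid A * B \mid A \mathbin{-\!*} B$. The set $\mathcal L$ of labels is enumerated without repetition as $a_0,a_1,a_2,\dots$ with $a_0=\epsilon$ the label constant and all other labels label variables. A relational atom is $x=y$, $x\neq y$ or $(x,y\triangleright z)$ with $x,y,z\in\mathcal L$; a labelled formula is $a:A$; a sequent $\mathcal G;\Gamma\vdash\Delta$ consists of a set $\mathcal G$ of relational atoms and sets $\Gamma,\Delta$ of labelled formulae. $E(\mathcal G)\vdash x=y$ means that $(x,y)$ is in the least equivalence relation on $\mathcal L$ containing all $(u,v)$ with $(u=v)\in\mathcal G$; $x=_{\mathcal G}y$ means $E(\mathcal G_f)\vdash x=y$ for some finite $\mathcal G_f\subseteq\mathcal G$. **Frame axioms.** A frame axiom has the form $$\forall x_1,\dots,x_m.\,(s_1=t_1\,\&\cdots\&\,s_p=t_p\,\&\,S_1\,\&\cdots\&\,S_k\Rightarrow\exists y_1,\dots,y_n.\,(T_1\,\&\cdots\&\,T_l)),$$ where the $s_i,t_i$ are variables $x_u$ or $\epsilon$, the $S_i$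 are inequalities or ternary atoms over the $x$'s and $\epsilon$, and the $T_i$ are relational atoms over the $x$'s, $y$'s and $\epsilon$. Fix a finite family $\mathcal{F}r$ of frame axioms. Let $k_{max}$ and $n_{max}$ be the largest $k$ and $n$ in $\mathcal{F}r$ ($0$ if $\mathcal{F}r$ is empty) and $\alpha=\max(n_{max},2)$. **Calculus.** The corresponding instance of $LS_G$ has the following (cut-free) rules, written premises $\Rightarrow$ conclusion, with semicolons denoting union. $id$: $\mathcal G;\Gamma;w:p\vdash w':p;\Delta$ if $E(\mathcal G)\vdash w=w'$. $\bot L$: $\mathcal G;\Gamma;w:\bot\vdash\Delta$. $\top R$: $\mathcal G;\Gamma\vdash w:\top;\Delta$. $\top^*L$: $\mathcal G;w=\epsilon;\Gamma\vdash\Delta\ \Rightarrow\ \mathcal G;\Gamma;w:\top^*\vdash\Delta$. $\top^*R$: $\mathcal G;\Gamma\vdash w:\top^*;\Delta$ if $E(\mathcal G)\vdash w=\epsilon$. The usual classical rules for $\land$ and $\to$, acting on one label. $*L$: $\mathcal G;(x,y\triangleright z);\Gamma;x:A;y:B\vdash\Delta\ \Rightarrow\ \mathcal G;\Gamma;z:A*B\vdash\Delta$,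 with $x,y$ fresh. $*R$: if $E(\mathcal G)\vdash z=z'$, from $\mathcal G;(x,y\triangleright z');\Gamma\vdash x:A;z:A*B;\Delta$ and $\mathcal G;(x,y\triangleright z');\Gamma\vdash y:B;z:A*B;\Delta$ infer $\mathcal G;(x,y\triangleright z');\Gamma\vdash z:A*B;\Delta$. $-\!*L$: if $E(\mathcal G)\vdash z=z'$, from $\mathcal G;(x,z'\triangleright y);\Gamma;z:A\mathbin{-\!*}B\vdash x:A;\Delta$ and $\mathcal G;(x,z'\triangleright y);\Gamma;z:A\mathbin{-\!*}B;y:B\vdash\Delta$ infer $\mathcal G;(x,z'\triangleright y);\Gamma;z:A\mathbin{-\!*}B\vdash\Delta$. $-\!*R$: $\mathcal G;(x,z\triangleright y);\Gamma;x:A\vdash y:B;\Delta\ \Rightarrow\ \mathcal G;\Gamma\vdash z:A\mathbin{-\!*}B;\Delta$, with $x,y$ fresh. $NEq$: $\mathcal G;w\neq w';\Gamma\vdash\Delta$ if $E(\mathcal G)\vdash w=w'$. $EM$: from $\mathcal G;w=w';\Gamma\vdash\Delta$ and $\mathcal G;w\neq w';\Gamma\vdash\Delta$ infer $\mathcal G;\Gamma\vdash\Delta$.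 For each frame axiom in $\mathcal{F}r$ and all substitutions $\theta$ of labels for $x_1,\dots,x_m$ and $\sigma$ of fresh labels for $y_1,\dots,y_n$: if $E(\mathcal G)\vdash s_i\theta=t_i\theta$ for all $i$, from $\mathcal G;S_1\theta;\dots;S_k\theta;(T_1\theta)\sigma;\dots;(T_l\theta)\sigma;\Gamma\vdash\Delta$ infer $\mathcal G;S_1\theta;\dots;S_k\theta;\Gamma\vdash\Delta$. Fresh labels are pairwise distinct labels other than $\epsilon$ that do not occur in the conclusion (nor, in the last rule, among the $x_i\theta$). $F$ is *unprovable* if $\vdash w:F$ has no derivation for any label $w\neq\epsilon$. **Scheduler.** Extended formulae are the formulae, a constant $\mathbb{EM}$, and a constant $\mathbb{GS}_{j,\theta}$ for each $j$-th frame axiom and each substitution $\theta$ of labels for its variables $x_1,\dots,x_m$. A schedule is $(O,m,\mathcal F,\mathcal R)$ with $O\in\{0,1\}$, $m\in\mathcal L$, $\mathcal F$ an extended formula and $\mathcal R$ a set of at most $\max(1,k_{max})$ relational atoms. A scheduler $\phi$ is a function from $\mathbb N$ to schedules; it is fair if every schedule is $\phi(i)$ for infinitely many $i$. Fix a fair scheduler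 $\phi$. **Construction.** Put $\mathcal G_1=\Gamma_1=\emptyset$, $\Delta_1=\{a_1:F\}$. For $i\ge1$ let $\phi(i)=(O,m,\mathcal F,\mathcal R)$ and obtain the $(i+1)$-st sequent from the $i$-th one as follows. * $O=0$, $\mathcal F=C$ a formula, $m:C\in\Gamma_i$. $C=A\land B$: add $m:A,m:B$ to $\Gamma$. $C=A\to B$: add $m:A$ to $\Delta$ if $\mathcal G_i;\Gamma_i\vdash m:A;\Delta_i$ is not derivable, otherwise $m:B$ to $\Gamma$. $C=\top^*$: add $m=\epsilon$ to $\mathcal G$. $C=A*B$: add $(a_{\alpha i},a_{\alpha i+1}\triangleright m)$ to $\mathcal G$ and $a_{\alpha i}:A$, $a_{\alpha i+1}:B$ to $\Gamma$. $C=A\mathbin{-\!*}B$, $\mathcal R=\{(x,m'\triangleright y)\}\subseteq\mathcal G_i$ and $E(\mathcal G_i)\vdash m'=m$: add $x:A$ to $\Delta$ if $\mathcal G_i;\Gamma_i\vdash x:A;\Delta_i$ is not derivable, otherwise $y:B$ to $\Gamma$. * $O=1$, $\mathcal F=C$ a formula, $m:C\in\Delta_i$. $C=A\land B$: add $m:A$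 to $\Delta$ if $\mathcal G_i;\Gamma_i\vdash m:A;\Delta_i$ is not derivable, otherwise $m:B$ to $\Delta$. $C=A\to B$: add $m:A$ to $\Gamma$, $m:B$ to $\Delta$. $C=A*B$, $\mathcal R=\{(x,y\triangleright m')\}\subseteq\mathcal G_i$ and $E(\mathcal G_i)\vdash m=m'$: add $x:A$ to $\Delta$ if $\mathcal G_i;\Gamma_i\vdash x:A;\Delta_i$ is not derivable, otherwise $y:B$ to $\Delta$. $C=A\mathbin{-\!*}B$: add $(a_{\alpha i},m\triangleright a_{\alpha i+1})$ to $\mathcal G$, $a_{\alpha i}:A$ to $\Gamma$, $a_{\alpha i+1}:B$ to $\Delta$. * $\mathcal F=\mathbb{EM}$, $\mathcal R=\{(w,w'\triangleright w'')\}$ with $w,w'\in\{a_0,\dots,a_{\alpha i+\alpha-1}\}$: add $w=w'$ to $\mathcal G$ if $w=w';\mathcal G_i;\Gamma_i\vdash\Delta_i$ is not derivable, otherwise add $w\neq w'$. * $\mathcal F=\mathbb{GS}_{j,\theta}$, and the $j$-th frame axiom satisfies $\{S_1\theta,\dots,S_k\theta\}=\mathcal R\subseteq\mathcal G_i$, $E(\mathcal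 G_i)\vdash s_u\theta=t_u\theta$ for all $u$, and all $x_u\theta$ are in $\{a_0,\dots,a_{\alpha i-1}\}$: add $(T_1\theta)\sigma,\dots,(T_l\theta)\sigma$ to $\mathcal G$, where $y_v\sigma=a_{\alpha i+v-1}$. * In all other cases nothing changes. The *limit sequent for $F$* is $\mathcal G^\omega;\Gamma^\omega\vdash\Delta^\omega$ with $\mathcal G^\omega=\bigcup_{i\ge1}\mathcal G_i$, $\Gamma^\omega=\bigcup_{i\ge1}\Gamma_i$, $\Delta^\omega=\bigcup_{i\ge1}\Delta_i$. **Hintikka sequents.** $\mathcal G;\Gamma\vdash\Delta$ is an *$\mathcal{F}r$-Hintikka sequent* if for all formulae $A,B$ and labels $a,b,z$: (1) not ($a:A\in\Gamma$, $b:A\in\Delta$ and $a=_{\mathcal G}b$); (2) $a:\bot\notin\Gamma$ and $a:\top\notin\Delta$; (3) $a:\top^*\in\Gamma$ implies $a=_{\mathcal G}\epsilon$; (4) $a:\top^*\in\Delta$ implies $a\neq_{\mathcal G}\epsilon$; (5) $a:A\land B\in\Gamma$ implies $a:A\in\Gamma$ and $a:B\in\Gamma$; (6) $a:A\land B\in\Delta$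 implies $a:A\in\Delta$ or $a:B\in\Delta$; (7) $a:A\to B\in\Gamma$ implies $a:A\in\Delta$ or $a:B\in\Gamma$; (8) $a:A\to B\in\Delta$ implies $a:A\in\Gamma$ and $a:B\in\Delta$; (9) $z:A*B\in\Gamma$ implies that there are $x,y,z'$ with $(x,y\triangleright z')\in\mathcal G$, $z=_{\mathcal G}z'$, $x:A\in\Gamma$, $y:B\in\Gamma$; (10) if $z:A*B\in\Delta$, then for all $x,y,z'$ with $(x,y\triangleright z')\in\mathcal G$ and $z=_{\mathcal G}z'$, $x:A\in\Delta$ or $y:B\in\Delta$; (11) if $z:A\mathbin{-\!*}B\in\Gamma$, then for all $x,y,z'$ with $(x,z'\triangleright y)\in\mathcal G$ and $z=_{\mathcal G}z'$, $x:A\in\Delta$ or $y:B\in\Gamma$; (12) $z:A\mathbin{-\!*}B\in\Delta$ implies that there are $x,y,z'$ with $(x,z'\triangleright y)\in\mathcal G$, $z=_{\mathcal G}z'$, $x:A\in\Gamma$, $y:B\in\Delta$; (13) not ($a\neq b\in\mathcal G$ and $a=_{\mathcal G}b$); (14) $a\neq b\in\mathcal G$ or $a=_{\mathcal G}b$; (15)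 for each frame axiom in $\mathcal{F}r$ and each substitution $\theta$ of labels for $x_1,\dots,x_m$, if $\{S_1\theta,\dots,S_k\theta\}\subseteq\mathcal G$ and $s_i\theta=_{\mathcal G}t_i\theta$ for all $i$, then there is a substitution $\sigma$ of labels for $y_1,\dots,y_n$ with $\{(T_1\theta)\sigma,\dots,(T_l\theta)\sigma\}\subseteq\mathcal G$. **Lemma.** For every finite family $\mathcal{F}r$ of frame axioms and every fair scheduler $\phi$, if $F$ is unprovable in the corresponding instance of $LS_G$, then the limit sequent for $F$ is an $\mathcal{F}r$-Hintikka sequent. -/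

import Mathlib

namespace SepLogic

open scoped Classical

/-- Formulae of propositional abstract separation logic over propositional variables `P`
(negation and disjunction are derived connectives). -/
inductive Formula (P : Type*) : Type _
  | var (p : P)
  | top
  | bot
  | emp
  | and (A B : Formula P)
  | imp (A B : Formula P)
  | star (A B : Formula P)
  | wand (A B : Formula P)

/-- Labels: the set of labels is enumerated without repetition as `a₀, a₁, a₂, …`, where `a₀` is
the label constant `ε` and the others are the label variables. The label `aᵢ` is `i`. -/
abbrev Label : Type := ℕ

/-- The label constant for the unit. -/
def eps : Label := 0

/-- Relational atoms over `X`: `x = y`, `x ≠ y`, and the ternary atoms `(x, y ▷ z)`. -/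
inductive RelAtom (X : Type) : Type
  | eq (x y : X)
  | neq (x y : X)
  | tern (x y z : X)

namespace RelAtom

/-- Apply a map to each argument of a relational atom. -/
def map {X Y : Type} (f : X → Y) : RelAtom X → RelAtom Y
  | eq x y => eq (f x) (f y)
  | neq x y => neq (f x) (f y)
  | tern x y z => tern (f x) (f y) (f z)

/-- The set of arguments occurring in a relational atom. -/
def args {X : Type} : RelAtom X → Set X
  | eq x y => {x, y}
  | neq x y => {x, y}
  | tern x y z => {x, y, z}

/-- The atom is an equality. -/
def IsEq {X : Type} : RelAtom X → Prop
  | eq _ _ => True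
  | neq _ _ => False
  | tern _ _ _ => False

end RelAtom

/-- A labelled formula `a : A`. -/
abbrev LFormula (P : Type*) : Type _ := Label × Formula P

/-- A labelled sequent `G; Γ ⊢ Δ` (the three sets may be infinite). -/
@[ext]
structure Sequent (P : Type*) where
  rel : Set (RelAtom Label)
  left : Set (LFormula P)
  right : Set (LFormula P)

/-- The set of labels occurring in a sequent. -/
def Sequent.labels {P : Type*} (s : Sequent P) : Set Label :=
  {a | (∃ r ∈ s.rel, a ∈ r.args) ∨ (∃ C, (a, C) ∈ s.left) ∨ (∃ C, (a, C) ∈ s.right)}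

/-- The equality judgment `E(G) ⊢ x = y`. -/
inductive EqJudg (G : Set (RelAtom Label)) : Label → Label → Prop
  | hyp {x y : Label} : RelAtom.eq x y ∈ G → EqJudg G x y
  | refl (x : Label) : EqJudg G x x
  | symm {x y : Label} : EqJudg G x y → EqJudg G y x
  | trans {x y z : Label} : EqJudg G x y → EqJudg G y z → EqJudg G x z

/-- The relation `x =_G y` for a possibly infinite `G`: the equality judgment holds for some
finite subset of `G`. -/
def EqMod (G : Set (RelAtom Label)) (x y : Label) : Prop :=
  ∃ G' ⊆ G, G'.Finite ∧ EqJudg G' x y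

/-- Terms of frame axioms: a first-order variable or the constant `ε`. -/
inductive LTerm (V : Type) : Type
  | var (v : V)
  | eps

/-- The label obtained from a term by substituting labels for its variables. -/
def LTerm.inst {V : Type} (f : V → Label) : LTerm V → Label
  | .var v => f v
  | .eps => SepLogic.eps

/-- A frame axiom
`∀ x₁ … xₘ. (s₁ = t₁ & … & sₚ = tₚ & S₁ & … & Sₖ ⇒ ∃ y₁ … yₙ. (T₁ & … & Tₗ))`,
where the `Sᵢ` are inequalities or ternary atoms over the `x`'s and `ε`, and the `Tᵢ` are arbitrary
relational atoms over the `x`'s, the `y`'s and `ε`. -/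
structure FrameAxiom where
  m : ℕ
  n : ℕ
  eqs : List (LTerm (Fin m) × LTerm (Fin m))
  hyps : List (RelAtom (LTerm (Fin m)))
  concls : List (RelAtom (LTerm (Fin m ⊕ Fin n)))
  hyps_not_eq : ∀ S ∈ hyps, ¬ S.IsEq

namespace FrameAxiom

/-- The set `{S₁θ, …, Sₖθ}`. -/
def hypsInst (ax : FrameAxiom) (θ : Fin ax.m → Label) : Set (RelAtom Label) :=
  {r | ∃ S ∈ ax.hyps, r = S.map (LTerm.inst θ)}

/-- The set `{(T₁θ)σ, …, (Tₗθ)σ}`. -/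
def conclsInst (ax : FrameAxiom) (θ : Fin ax.m → Label) (σ : Fin ax.n → Label) :
    Set (RelAtom Label) :=
  {r | ∃ T ∈ ax.concls, r = T.map (LTerm.inst (Sum.elim θ σ))}

/-- `E(G) ⊢ sᵢθ = tᵢθ` for all `i`. -/
def EqsHold (ax : FrameAxiom) (G : Set (RelAtom Label)) (θ : Fin ax.m → Label) : Prop :=
  ∀ e ∈ ax.eqs, EqJudg G (e.1.inst θ) (e.2.inst θ)

end FrameAxiom

/-- Cut-free derivability in the instance of `LS_G` whose structural rules are synthesised from the
frame axioms `Fr`. The labels introduced by `starL`, `wandR` and the structural rules are pairwise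
distinct label variables (so different from `ε`) that do not occur in the conclusion. (The premises
of a rule with a finite conclusion are finite, so a derivation of a finite sequent consists of
finite sequents.) -/
inductive Derivable {P : Type*} {q : ℕ} (Fr : Fin q → FrameAxiom) : Sequent P → Prop
  | id {G Γ Δ} {w w' : Label} {p : P} :
      EqJudg G w w' →
      Derivable Fr ⟨G, insert (w, .var p) Γ, insert (w', .var p) Δ⟩
  | botL {G Γ Δ} {w : Label} :
      Derivable Fr ⟨G, insert (w, .bot) Γ, Δ⟩
  | topR {G Γ Δ} {w : Label} :
      Derivable Fr ⟨G, Γ, insert (w, .top) Δ⟩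
  | empL {G Γ Δ} {w : Label} :
      Derivable Fr ⟨insert (.eq w eps) G, Γ, Δ⟩ →
      Derivable Fr ⟨G, insert (w, .emp) Γ, Δ⟩
  | empR {G Γ Δ} {w : Label} :
      EqJudg G w eps →
      Derivable Fr ⟨G, Γ, insert (w, .emp) Δ⟩
  | andL {G Γ Δ} {w : Label} {A B : Formula P} :
      Derivable Fr ⟨G, insert (w, A) (insert (w, B) Γ), Δ⟩ →
      Derivable Fr ⟨G, insert (w, .and A B) Γ, Δ⟩
  | andR {G Γ Δ} {w : Label} {A B : Formula P} :
      Derivable Fr ⟨G, Γ, insert (w, A) Δ⟩ →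
      Derivable Fr ⟨G, Γ, insert (w, B) Δ⟩ →
      Derivable Fr ⟨G, Γ, insert (w, .and A B) Δ⟩
  | impL {G Γ Δ} {w : Label} {A B : Formula P} :
      Derivable Fr ⟨G, Γ, insert (w, A) Δ⟩ →
      Derivable Fr ⟨G, insert (w, B) Γ, Δ⟩ →
      Derivable Fr ⟨G, insert (w, .imp A B) Γ, Δ⟩
  | impR {G Γ Δ} {w : Label} {A B : Formula P} :
      Derivable Fr ⟨G, insert (w, A) Γ, insert (w, B) Δ⟩ →
      Derivable Fr ⟨G, Γ, insert (w, .imp A B) Δ⟩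
  | starL {G Γ Δ} {x y z : Label} {A B : Formula P} :
      x ≠ y → x ≠ eps → y ≠ eps →
      x ∉ Sequent.labels ⟨G, insert (z, .star A B) Γ, Δ⟩ →
      y ∉ Sequent.labels ⟨G, insert (z, .star A B) Γ, Δ⟩ →
      Derivable Fr ⟨insert (.tern x y z) G, insert (x, A) (insert (y, B) Γ), Δ⟩ →
      Derivable Fr ⟨G, insert (z, .star A B) Γ, Δ⟩
  | starR {G Γ Δ} {x y z z' : Label} {A B : Formula P} :
      EqJudg G z z' →
      Derivable Fr ⟨insert (.tern x y z') G, Γ, insert (x, A) (insert (z, .star A B) Δ)⟩ →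
      Derivable Fr ⟨insert (.tern x y z') G, Γ, insert (y, B) (insert (z, .star A B) Δ)⟩ →
      Derivable Fr ⟨insert (.tern x y z') G, Γ, insert (z, .star A B) Δ⟩
  | wandL {G Γ Δ} {x y z z' : Label} {A B : Formula P} :
      EqJudg G z z' →
      Derivable Fr ⟨insert (.tern x z' y) G, insert (z, .wand A B) Γ, insert (x, A) Δ⟩ →
      Derivable Fr ⟨insert (.tern x z' y) G, insert (y, B) (insert (z, .wand A B) Γ), Δ⟩ →
      Derivable Fr ⟨insert (.tern x z' y) G, insert (z, .wand A B) Γ, Δ⟩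
  | wandR {G Γ Δ} {x y z : Label} {A B : Formula P} :
      x ≠ y → x ≠ eps → y ≠ eps →
      x ∉ Sequent.labels ⟨G, Γ, insert (z, .wand A B) Δ⟩ →
      y ∉ Sequent.labels ⟨G, Γ, insert (z, .wand A B) Δ⟩ →
      Derivable Fr ⟨insert (.tern x z y) G, insert (x, A) Γ, insert (y, B) Δ⟩ →
      Derivable Fr ⟨G, Γ, insert (z, .wand A B) Δ⟩
  | nEq {G Γ Δ} {w w' : Label} :
      EqJudg G w w' →
      Derivable Fr ⟨insert (.neq w w') G, Γ, Δ⟩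
  | em {G Γ Δ} (w w' : Label) :
      Derivable Fr ⟨insert (.eq w w') G, Γ, Δ⟩ →
      Derivable Fr ⟨insert (.neq w w') G, Γ, Δ⟩ →
      Derivable Fr ⟨G, Γ, Δ⟩
  | structural {G Γ Δ} (j : Fin q) (θ : Fin (Fr j).m → Label) (σ : Fin (Fr j).n → Label) :
      (Fr j).EqsHold G θ →
      Function.Injective σ →
      (∀ v, σ v ≠ eps ∧ σ v ∉ Set.range θ ∧
        σ v ∉ Sequent.labels ⟨G ∪ (Fr j).hypsInst θ, Γ, Δ⟩) →
      Derivable Fr ⟨G ∪ (Fr j).hypsInst θ ∪ (Fr j).conclsInst θ σ, Γ, Δ⟩ →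
      Derivable Fr ⟨G ∪ (Fr j).hypsInst θ, Γ, Δ⟩

/-- `F` is unprovable: `⊢ w : F` has no cut-free derivation, for any label `w ≠ ε`. -/
def Unprovable {P : Type*} {q : ℕ} (Fr : Fin q → FrameAxiom) (F : Formula P) : Prop :=
  ∀ w : Label, w ≠ eps → ¬ Derivable Fr ⟨∅, ∅, {(w, F)}⟩

/-- The `Fr`-Hintikka sequents: conditions 1 to 14 of general Hintikka sequents, and condition 15
for each frame axiom in `Fr`. -/
structure IsHintikka {P : Type*} {q : ℕ} (Fr : Fin q → FrameAxiom) (s : Sequent P) : Prop where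
  c1 : ∀ (A : Formula P) (a b : Label),
    ¬ ((a, A) ∈ s.left ∧ (b, A) ∈ s.right ∧ EqMod s.rel a b)
  c2 : ∀ a : Label, (a, Formula.bot) ∉ s.left ∧ (a, Formula.top) ∉ s.right
  c3 : ∀ a : Label, (a, Formula.emp) ∈ s.left → EqMod s.rel a eps
  c4 : ∀ a : Label, (a, Formula.emp) ∈ s.right → ¬ EqMod s.rel a eps
  c5 : ∀ (A B : Formula P) (a : Label),
    (a, A.and B) ∈ s.left → (a, A) ∈ s.left ∧ (a, B) ∈ s.left
  c6 : ∀ (A B : Formula P) (a : Label),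
    (a, A.and B) ∈ s.right → (a, A) ∈ s.right ∨ (a, B) ∈ s.right
  c7 : ∀ (A B : Formula P) (a : Label),
    (a, A.imp B) ∈ s.left → (a, A) ∈ s.right ∨ (a, B) ∈ s.left
  c8 : ∀ (A B : Formula P) (a : Label),
    (a, A.imp B) ∈ s.right → (a, A) ∈ s.left ∧ (a, B) ∈ s.right
  c9 : ∀ (A B : Formula P) (z : Label), (z, A.star B) ∈ s.left →
    ∃ x y z' : Label, RelAtom.tern x y z' ∈ s.rel ∧ EqMod s.rel z z' ∧
      (x, A) ∈ s.left ∧ (y, B) ∈ s.left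
  c10 : ∀ (A B : Formula P) (z : Label), (z, A.star B) ∈ s.right →
    ∀ x y z' : Label, RelAtom.tern x y z' ∈ s.rel → EqMod s.rel z z' →
      (x, A) ∈ s.right ∨ (y, B) ∈ s.right
  c11 : ∀ (A B : Formula P) (z : Label), (z, A.wand B) ∈ s.left →
    ∀ x y z' : Label, RelAtom.tern x z' y ∈ s.rel → EqMod s.rel z z' →
      (x, A) ∈ s.right ∨ (y, B) ∈ s.left
  c12 : ∀ (A B : Formula P) (z : Label), (z, A.wand B) ∈ s.right →
    ∃ x y z' : Label, RelAtom.tern x z' y ∈ s.rel ∧ EqMod s.rel z z' ∧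
      (x, A) ∈ s.left ∧ (y, B) ∈ s.right
  c13 : ∀ a b : Label, ¬ (RelAtom.neq a b ∈ s.rel ∧ EqMod s.rel a b)
  c14 : ∀ a b : Label, RelAtom.neq a b ∈ s.rel ∨ EqMod s.rel a b
  c15 : ∀ (j : Fin q) (θ : Fin (Fr j).m → Label),
    (Fr j).hypsInst θ ⊆ s.rel →
    (∀ e ∈ (Fr j).eqs, EqMod s.rel (e.1.inst θ) (e.2.inst θ)) →
    ∃ σ : Fin (Fr j).n → Label, (Fr j).conclsInst θ σ ⊆ s.rel

/-- The largest number of atoms `Sᵢ` in a frame axiom of `Fr` (`0` if `Fr` is empty). -/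
def kMax {q : ℕ} (Fr : Fin q → FrameAxiom) : ℕ :=
  Finset.univ.sup fun j => (Fr j).hyps.length

/-- The largest number of existential variables in a frame axiom of `Fr` (`0` if `Fr` is empty). -/
def nMax {q : ℕ} (Fr : Fin q → FrameAxiom) : ℕ :=
  Finset.univ.sup fun j => (Fr j).n

/-- The number `α = max(n_max, 2)` of labels reserved for each stage. -/
def alpha {q : ℕ} (Fr : Fin q → FrameAxiom) : ℕ := max (nMax Fr) 2

/-- Extended formulae: formulae, and dummy principal formulae for the rule `EM` and for the
instances (given by a substitution `θ` for the universal variables) of the structural rules. -/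
inductive ExFormula (P : Type*) {q : ℕ} (Fr : Fin q → FrameAxiom) : Type _
  | fml (A : Formula P)
  | em
  | gs (j : Fin q) (θ : Fin (Fr j).m → Label)

/-- The side of the turnstile (`0` for left and `1` for right). -/
inductive Side : Type
  | left
  | right

/-- A schedule `(O, m, F, R)`; the set `R` of relational atoms has at most `max(1, k_max)`
elements. -/
structure Schedule (P : Type*) {q : ℕ} (Fr : Fin q → FrameAxiom) where
  side : Side
  label : Label
  exf : ExFormula P Fr
  atoms : Finset (RelAtom Label)
  card_le : atoms.card ≤ max 1 (kMax Fr)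

/-- A scheduler is fair if every schedule occurs infinitely often. -/
def Fair {P : Type*} {q : ℕ} {Fr : Fin q → FrameAxiom} (φ : ℕ → Schedule P Fr) : Prop :=
  ∀ S : Schedule P Fr, {i | φ i = S}.Infinite

/-- The arguments of the ternary atom in a set that consists of exactly one ternary atom. -/
noncomputable def theTern (R : Finset (RelAtom Label)) : Option (Label × Label × Label) :=
  if h : ∃ t : Label × Label × Label, R = {RelAtom.tern t.1 t.2.1 t.2.2} then some h.choose
  else none

theorem theTern_eq_some (R : Finset (RelAtom Label)) (x y z : Label) :
    theTern R = some (x, y, z) ↔ R = {RelAtom.tern x y z} := by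
  unfold theTern
  split_ifs with h
  · have hs := h.choose_spec
    rw [Option.some_inj]
    constructor
    · intro e
      rw [e] at hs
      exact hs
    · intro e
      have hs' := Finset.singleton_inj.mp (e.symm.trans hs)
      injection hs' with h1 h2 h3
      exact Prod.ext h1.symm (Prod.ext h2.symm h3.symm)
  · simp only [false_iff]
    intro e
    exact h ⟨(x, y, z), e⟩

/-- Stage `i` of the construction for a labelled formula `m : C` on the left. -/
noncomputable def stepLeft {P : Type*} {q : ℕ} (Fr : Fin q → FrameAxiom) (i : ℕ) (m : Label)
    (C : Formula P) (R : Finset (RelAtom Label)) (s : Sequent P) : Sequent P :=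
  match C with
  | .and A B => ⟨s.rel, s.left ∪ {(m, A), (m, B)}, s.right⟩
  | .imp A B =>
      if ¬ Derivable Fr ⟨s.rel, s.left, insert (m, A) s.right⟩ then
        ⟨s.rel, s.left, s.right ∪ {(m, A)}⟩
      else ⟨s.rel, s.left ∪ {(m, B)}, s.right⟩
  | .emp => ⟨s.rel ∪ {.eq m eps}, s.left, s.right⟩
  | .star A B =>
      ⟨s.rel ∪ {.tern (alpha Fr * i) (alpha Fr * i + 1) m},
        s.left ∪ {(alpha Fr * i, A), (alpha Fr * i + 1, B)}, s.right⟩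
  | .wand A B =>
      match theTern R with
      | some (x, m', y) =>
          if RelAtom.tern x m' y ∈ s.rel ∧ EqJudg s.rel m' m then
            if ¬ Derivable Fr ⟨s.rel, s.left, insert (x, A) s.right⟩ then
              ⟨s.rel, s.left, s.right ∪ {(x, A)}⟩
            else ⟨s.rel, s.left ∪ {(y, B)}, s.right⟩
          else s
      | none => s
  | _ => s

/-- Stage `i` of the construction for a labelled formula `m : C` on the right. -/
noncomputable def stepRight {P : Type*} {q : ℕ} (Fr : Fin q → FrameAxiom) (i : ℕ) (m : Label)
    (C : Formula P) (R : Finset (RelAtom Label)) (s : Sequent P) : Sequent P :=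
  match C with
  | .and A B =>
      if ¬ Derivable Fr ⟨s.rel, s.left, insert (m, A) s.right⟩ then
        ⟨s.rel, s.left, s.right ∪ {(m, A)}⟩
      else ⟨s.rel, s.left, s.right ∪ {(m, B)}⟩
  | .imp A B => ⟨s.rel, s.left ∪ {(m, A)}, s.right ∪ {(m, B)}⟩
  | .star A B =>
      match theTern R with
      | some (x, y, m') =>
          if RelAtom.tern x y m' ∈ s.rel ∧ EqJudg s.rel m m' then
            if ¬ Derivable Fr ⟨s.rel, s.left, insert (x, A) s.right⟩ then
              ⟨s.rel, s.left, s.right ∪ {(x, A)}⟩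
            else ⟨s.rel, s.left, s.right ∪ {(y, B)}⟩
          else s
      | none => s
  | .wand A B =>
      ⟨s.rel ∪ {.tern (alpha Fr * i) m (alpha Fr * i + 1)},
        s.left ∪ {(alpha Fr * i, A)}, s.right ∪ {(alpha Fr * i + 1, B)}⟩
  | _ => s

/-- The sequent obtained from the `i`-th sequent `s` by the schedule `S`. -/
noncomputable def step {P : Type*} {q : ℕ} {Fr : Fin q → FrameAxiom} (i : ℕ)
    (S : Schedule P Fr) (s : Sequent P) : Sequent P :=
  match S.exf with
  | .fml C =>
      match S.side with
      | .left => if (S.label, C) ∈ s.left then stepLeft Fr i S.label C S.atoms s else s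
      | .right => if (S.label, C) ∈ s.right then stepRight Fr i S.label C S.atoms s else s
  | .em =>
      match theTern S.atoms with
      | some (w, w', _) =>
          if w < alpha Fr * i + alpha Fr ∧ w' < alpha Fr * i + alpha Fr then
            if ¬ Derivable Fr ⟨insert (.eq w w') s.rel, s.left, s.right⟩ then
              ⟨s.rel ∪ {.eq w w'}, s.left, s.right⟩
            else ⟨s.rel ∪ {.neq w w'}, s.left, s.right⟩
          else s
      | none => s
  | .gs j θ =>
      if (Fr j).hypsInst θ = ↑S.atoms ∧ (Fr j).hypsInst θ ⊆ s.rel ∧ (Fr j).EqsHold s.rel θ ∧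
          ∀ u, θ u < alpha Fr * i then
        ⟨s.rel ∪ (Fr j).conclsInst θ (fun v => alpha Fr * i + v), s.left, s.right⟩
      else s

/-- The series of sequents constructed from `F`, which starts with index `1`:
`stage φ F n` is the sequent with index `n + 1`. -/
noncomputable def stage {P : Type*} {q : ℕ} {Fr : Fin q → FrameAxiom} (φ : ℕ → Schedule P Fr)
    (F : Formula P) : ℕ → Sequent P
  | 0 => ⟨∅, ∅, {(1, F)}⟩
  | n + 1 => step (n + 1) (φ (n + 1)) (stage φ F n)

/-- The limit sequent for `F`: the componentwise union of the series of sequents. -/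
noncomputable def limitSequent {P : Type*} {q : ℕ} {Fr : Fin q → FrameAxiom}
    (φ : ℕ → Schedule P Fr) (F : Formula P) : Sequent P :=
  ⟨⋃ n, (stage φ F n).rel, ⋃ n, (stage φ F n).left, ⋃ n, (stage φ F n).right⟩

end SepLogic

namespace SepLogic

section

variable {P : Type*} {q : ℕ} {Fr : Fin q → FrameAxiom}

/-! Every sequent of the series is underivable, and every label in the `i`-th one is below `alpha Fr
* i` (`good_stage`). The label bound makes the block reserved for step `i` fresh. Underivability
survives a step because each step passes from the conclusion of a rule to one of its premises: if
all premises were derivable, so would be the conclusion. At a branching rule the construction takes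
the first premise unless that one is derivable, in which case the second cannot be (`good_stepLeft`,
`good_stepRight`, `good_step`).

The stages increase, so a labelled formula or relational atom of the limit is present at all late
stages. The same holds for an equality modulo the limit, since it uses only finitely many atoms.
Finitely many such facts therefore hold together from some stage on.

The Hintikka conditions are then of two kinds. Conditions 1, 2, 4 and 13 forbid configurations; a
forbidden configuration would already appear at a finite stage and make it derivable by a
zero-premise rule or, for condition 1, by `derivable_identity`. The other conditions ask for
saturation; by fairness (`Fair.exists_step`) the relevant schedule comes up after all its
prerequisites have appeared, and that step adds what is required. -/

/-! ### Equality judgments and label bounds -/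

theorem EqJudg.mono {G G' : Set (RelAtom Label)} (h : G ⊆ G') {x y : Label}
    (e : EqJudg G x y) : EqJudg G' x y := by
  induction e with
  | hyp hm => exact .hyp (h hm)
  | refl x => exact .refl x
  | symm _ ih => exact ih.symm
  | trans _ _ ih₁ ih₂ => exact ih₁.trans ih₂

/-- Compactness: a derivation of an equality judgment is a finite tree, so it uses finitely many
atoms. -/
theorem EqJudg.eqMod {G : Set (RelAtom Label)} {x y : Label} (e : EqJudg G x y) :
    EqMod G x y := by
  induction e with
  | @hyp x y hm =>
    exact ⟨{.eq x y}, Set.singleton_subset_iff.2 hm, Set.finite_singleton _, .hyp rfl⟩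
  | refl x => exact ⟨∅, Set.empty_subset _, Set.finite_empty, .refl x⟩
  | symm _ ih =>
    obtain ⟨G', hs, hf, e⟩ := ih
    exact ⟨G', hs, hf, e.symm⟩
  | trans _ _ ih₁ ih₂ =>
    obtain ⟨G₁, hs₁, hf₁, e₁⟩ := ih₁
    obtain ⟨G₂, hs₂, hf₂, e₂⟩ := ih₂
    exact ⟨G₁ ∪ G₂, Set.union_subset hs₁ hs₂, hf₁.union hf₂,
      (e₁.mono Set.subset_union_left).trans (e₂.mono Set.subset_union_right)⟩

/-- All labels of the sequent are smaller than `N`. -/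
structure Sequent.Below (s : Sequent P) (N : ℕ) : Prop where
  rel : ∀ r ∈ s.rel, ∀ a ∈ r.args, a < N
  left : ∀ c ∈ s.left, c.1 < N
  right : ∀ c ∈ s.right, c.1 < N

/-- All freshness side conditions on the sequent's own labels are discharged through this numerical
bound. -/
theorem Sequent.Below.notMem_labels {s : Sequent P} {N a : ℕ} (h : s.Below N) (ha : N ≤ a) :
    a ∉ s.labels := by
  rintro (⟨r, hr, har⟩ | ⟨C, hC⟩ | ⟨C, hC⟩)
  · exact absurd (h.rel r hr a har) (by lia)
  · exact absurd (h.left _ hC) (not_lt.2 ha)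
  · exact absurd (h.right _ hC) (not_lt.2 ha)

theorem Sequent.Below.mono {s : Sequent P} {N M : ℕ} (h : s.Below N) (hNM : N ≤ M) :
    s.Below M :=
  ⟨fun r hr a ha => (h.rel r hr a ha).trans_le hNM, fun c hc => (h.left c hc).trans_le hNM,
    fun c hc => (h.right c hc).trans_le hNM⟩

theorem Sequent.Below.union {s : Sequent P} {N : ℕ} (h : s.Below N)
    {G : Set (RelAtom Label)} {Γ Δ : Set (LFormula P)}
    (hG : ∀ r ∈ G, ∀ a ∈ r.args, a < N) (hΓ : ∀ c ∈ Γ, c.1 < N) (hΔ : ∀ c ∈ Δ, c.1 < N) :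
    Sequent.Below ⟨s.rel ∪ G, s.left ∪ Γ, s.right ∪ Δ⟩ N :=
  ⟨fun r hr => hr.elim (h.rel r) (hG r), fun c hc => hc.elim (h.left c) (hΓ c),
    fun c hc => hc.elim (h.right c) (hΔ c)⟩

/-! ### Identity sequents for compound formulae -/

/-- Identity for arbitrary formulae. -/
theorem derivable_identity (A : Formula P) :
    ∀ (G : Set (RelAtom Label)) (Γ Δ : Set (LFormula P)) (w w' N : ℕ),
      Sequent.Below ⟨G, Γ, Δ⟩ N → (w, A) ∈ Γ → (w', A) ∈ Δ → EqJudg G w w' →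
      Derivable Fr ⟨G, Γ, Δ⟩ := by
  induction A with
  | var p =>
    intro G Γ Δ w w' N _ hl hr e
    -- Contexts are sets, so a principal formula may be split off and still remain in the context.
    -- Applied this way, rules keep their principal formula, and neither weakening nor contraction
    -- is needed.
    rw [← Set.insert_eq_of_mem hl, ← Set.insert_eq_of_mem hr]
    exact .id e
  | top =>
    intro G Γ Δ w w' N _ _ hr _
    rw [← Set.insert_eq_of_mem hr]
    exact .topR
  | bot =>
    intro G Γ Δ w w' N _ hl _ _
    rw [← Set.insert_eq_of_mem hl]
    exact .botL
  | emp =>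
    intro G Γ Δ w w' N _ hl hr e
    rw [← Set.insert_eq_of_mem hl, ← Set.insert_eq_of_mem hr]
    refine .empL (.empR ?_)
    exact (e.symm.mono (Set.subset_insert _ _)).trans (.hyp (Set.mem_insert _ _))
  | and A B ihA ihB =>
    intro G Γ Δ w w' N hN hl hr e
    have hw : w < N := hN.left _ hl
    have hw' : w' < N := hN.right _ hr
    rw [← Set.insert_eq_of_mem hl, ← Set.insert_eq_of_mem hr]
    refine .andL (.andR ?_ ?_)
    · refine ihA _ _ _ w w' N ⟨hN.rel, ?_, ?_⟩ (by simp) (by simp) e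
      · rintro c (rfl | rfl | hc)
        exacts [hw, hw, hN.left c hc]
      · rintro c (rfl | hc)
        exacts [hw', hN.right c hc]
    · refine ihB _ _ _ w w' N ⟨hN.rel, ?_, ?_⟩ (by simp) (by simp) e
      · rintro c (rfl | rfl | hc)
        exacts [hw, hw, hN.left c hc]
      · rintro c (rfl | hc)
        exacts [hw', hN.right c hc]
  | imp A B ihA ihB =>
    intro G Γ Δ w w' N hN hl hr e
    have hw : w < N := hN.left _ hl
    have hw' : w' < N := hN.right _ hr
    rw [← Set.insert_eq_of_mem hr]
    refine .impR ?_
    rw [← Set.insert_eq_of_mem hl, Set.insert_comm]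
    refine .impL ?_ ?_
    -- The antecedent changes sides: `A` is on the left at `w'` and on the right at `w`, so the two
    -- labels are swapped.
    · refine ihA _ _ _ w' w N ⟨hN.rel, ?_, ?_⟩ (by simp) (by simp) e.symm
      · rintro c (rfl | hc)
        exacts [hw', hN.left c hc]
      · rintro c (rfl | rfl | hc)
        exacts [hw, hw', hN.right c hc]
    · refine ihB _ _ _ w w' N ⟨hN.rel, ?_, ?_⟩ (by simp) (by simp) e
      · rintro c (rfl | rfl | hc)
        exacts [hw, hw', hN.left c hc]
      · rintro c (rfl | hc)
        exacts [hw', hN.right c hc]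
  | star A B ihA ihB =>
    intro G Γ Δ w w' N hN hl hr e
    have hw : w < N := hN.left _ hl
    have hw' : w' < N := hN.right _ hr
    have hrel : ∀ r ∈ insert (.tern N (N + 1) w) G, ∀ a ∈ r.args, a < N + 2 := by
      rintro r (rfl | h) a ha
      · simp only [RelAtom.args, Set.mem_insert_iff, Set.mem_singleton_iff] at ha
        lia
      · exact (hN.rel r h a ha).trans (by lia)
    have hleft : ∀ c ∈ insert ((N, A) : LFormula P) (insert (N + 1, B) Γ), c.1 < N + 2 := by
      rintro c (rfl | rfl | hc)
      · exact Nat.lt_add_of_pos_right two_pos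
      · exact Nat.lt_succ_self _
      · exact (hN.left c hc).trans (by lia)
    rw [← Set.insert_eq_of_mem hl]
    -- The bound supplies the fresh labels; `N` is not `eps` because `w < N`.
    refine .starL (x := N) (y := N + 1) (by lia) (by simp only [eps, ne_eq]; lia)
      (by simp only [eps, ne_eq]; lia) ?_ ?_ ?_
    · rw [Set.insert_eq_of_mem hl]
      exact hN.notMem_labels le_rfl
    · rw [Set.insert_eq_of_mem hl]
      exact hN.notMem_labels (Nat.le_succ N)
    rw [← Set.insert_eq_of_mem hr]
    -- The new atom splits `w` while the formula on the right sits at `w'`; the equality side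
    -- condition of the rule bridges the two. Each premise is then an identity at one of the fresh
    -- labels.
    refine .starR e.symm ?_ ?_
    · refine ihA _ _ _ N N (N + 2) ⟨hrel, hleft, ?_⟩ (by simp) (by simp) (.refl _)
      rintro c (rfl | rfl | hc)
      · exact Nat.lt_add_of_pos_right two_pos
      · exact hw'.trans (by lia)
      · exact (hN.right c hc).trans (by lia)
    · refine ihB _ _ _ (N + 1) (N + 1) (N + 2) ⟨hrel, hleft, ?_⟩ (by simp) (by simp) (.refl _)
      rintro c (rfl | rfl | hc)
      · exact Nat.lt_succ_self _
      · exact hw'.trans (by lia)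
      · exact (hN.right c hc).trans (by lia)
  | wand A B ihA ihB =>
    intro G Γ Δ w w' N hN hl hr e
    have hw : w < N := hN.left _ hl
    have hw' : w' < N := hN.right _ hr
    have hrel : ∀ r ∈ insert (.tern N w' (N + 1)) G, ∀ a ∈ r.args, a < N + 2 := by
      rintro r (rfl | h) a ha
      · simp only [RelAtom.args, Set.mem_insert_iff, Set.mem_singleton_iff] at ha
        lia
      · exact (hN.rel r h a ha).trans (by lia)
    rw [← Set.insert_eq_of_mem hr]
    refine .wandR (x := N) (y := N + 1) (by lia) (by simp only [eps, ne_eq]; lia)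
      (by simp only [eps, ne_eq]; lia) ?_ ?_ ?_
    · rw [Set.insert_eq_of_mem hr]
      exact hN.notMem_labels le_rfl
    · rw [Set.insert_eq_of_mem hr]
      exact hN.notMem_labels (Nat.le_succ N)
    rw [← Set.insert_eq_of_mem hl, Set.insert_comm]
    refine .wandL e ?_ ?_
    · refine ihA _ _ _ N N (N + 2) ⟨hrel, ?_, ?_⟩ (by simp) (by simp) (.refl _)
      · rintro c (rfl | rfl | hc)
        · exact hw.trans (by lia)
        · exact Nat.lt_add_of_pos_right two_pos
        · exact (hN.left c hc).trans (by lia)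
      · rintro c (rfl | rfl | hc)
        · exact Nat.lt_add_of_pos_right two_pos
        · exact Nat.lt_succ_self _
        · exact (hN.right c hc).trans (by lia)
    · refine ihB _ _ _ (N + 1) (N + 1) (N + 2) ⟨hrel, ?_, ?_⟩ (by simp) (by simp) (.refl _)
      · rintro c (rfl | rfl | rfl | hc)
        · exact Nat.lt_succ_self _
        · exact hw.trans (by lia)
        · exact Nat.lt_add_of_pos_right two_pos
        · exact (hN.left c hc).trans (by lia)
      · rintro c (rfl | hc)
        · exact Nat.lt_succ_self _
        · exact (hN.right c hc).trans (by lia)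

/-! ### Monotonicity of the construction -/

/-- Componentwise inclusion of sequents. -/
structure Sequent.Sub (s t : Sequent P) : Prop where
  rel : s.rel ⊆ t.rel
  left : s.left ⊆ t.left
  right : s.right ⊆ t.right

theorem Sequent.Sub.refl (s : Sequent P) : s.Sub s :=
  ⟨subset_rfl, subset_rfl, subset_rfl⟩

theorem Sequent.Sub.trans {s t u : Sequent P} (h : s.Sub t) (h' : t.Sub u) : s.Sub u :=
  ⟨h.rel.trans h'.rel, h.left.trans h'.left, h.right.trans h'.right⟩

theorem sub_stepLeft (i : ℕ) (m : Label) (C : Formula P) (R : Finset (RelAtom Label))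
    (s : Sequent P) : s.Sub (stepLeft Fr i m C R s) := by
  unfold stepLeft
  repeat' split
  all_goals
    first
    | exact Sequent.Sub.refl s
    | constructor <;> first | exact subset_rfl | exact Set.subset_union_left

theorem sub_stepRight (i : ℕ) (m : Label) (C : Formula P) (R : Finset (RelAtom Label))
    (s : Sequent P) : s.Sub (stepRight Fr i m C R s) := by
  unfold stepRight
  repeat' split
  all_goals
    first
    | exact Sequent.Sub.refl s
    | constructor <;> first | exact subset_rfl | exact Set.subset_union_left

theorem sub_step (i : ℕ) (S : Schedule P Fr) (s : Sequent P) : s.Sub (step i S s) := by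
  unfold step
  repeat' split
  all_goals
    first
    | exact Sequent.Sub.refl s
    | exact sub_stepLeft ..
    | exact sub_stepRight ..
    | constructor <;> first | exact subset_rfl | exact Set.subset_union_left

/-! ### Size of the reserved blocks of labels -/

theorem two_le_alpha (Fr : Fin q → FrameAxiom) : 2 ≤ alpha Fr :=
  le_max_right _ _

theorem arity_le_alpha (Fr : Fin q → FrameAxiom) (j : Fin q) : (Fr j).n ≤ alpha Fr :=
  (Finset.le_sup (f := fun j => (Fr j).n) (Finset.mem_univ j)).trans (le_max_left _ _)

theorem length_le_kMax (Fr : Fin q → FrameAxiom) (j : Fin q) :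
    (Fr j).hyps.length ≤ kMax Fr :=
  Finset.le_sup (f := fun j => (Fr j).hyps.length) (Finset.mem_univ j)

theorem RelAtom.exists_of_mem_args_map {X Y : Type} {f : X → Y} {r : RelAtom X} {b : Y}
    (h : b ∈ (r.map f).args) : ∃ a, b = f a := by
  cases r <;>
    simp only [RelAtom.map, RelAtom.args, Set.mem_insert_iff, Set.mem_singleton_iff] at h
  · rcases h with h | h <;> exact ⟨_, h⟩
  · rcases h with h | h <;> exact ⟨_, h⟩
  · rcases h with h | h | h <;> exact ⟨_, h⟩

theorem FrameAxiom.lt_of_mem_conclsInst {ax : FrameAxiom} {θ : Fin ax.m → Label}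
    {σ : Fin ax.n → Label} {N : ℕ} (hN : 0 < N) (hθ : ∀ u, θ u < N) (hσ : ∀ v, σ v < N) :
    ∀ r ∈ ax.conclsInst θ σ, ∀ a ∈ r.args, a < N := by
  rintro r ⟨T, -, rfl⟩ a ha
  obtain ⟨t, rfl⟩ := RelAtom.exists_of_mem_args_map ha
  rcases t with (u | v) | _
  exacts [hθ u, hσ v, hN]

/-! ### Each step preserves underivability -/

/-- Sequents that are not derivable and whose labels are smaller than `N`. -/
structure Sequent.Good (Fr : Fin q → FrameAxiom) (s : Sequent P) (N : ℕ) : Prop where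
  below : s.Below N
  underivable : ¬ Derivable Fr s

theorem Sequent.Good.mono {s : Sequent P} {N M : ℕ} (h : s.Good Fr N) (hNM : N ≤ M) :
    s.Good Fr M :=
  ⟨h.below.mono hNM, h.underivable⟩

theorem Sequent.Good.union {s : Sequent P} {N M : ℕ} (h : s.Good Fr N) (hNM : N ≤ M)
    {G : Set (RelAtom Label)} {Γ Δ : Set (LFormula P)}
    (hG : ∀ r ∈ G, ∀ a ∈ r.args, a < M) (hΓ : ∀ c ∈ Γ, c.1 < M) (hΔ : ∀ c ∈ Δ, c.1 < M)
    (hd : ¬ Derivable Fr ⟨s.rel ∪ G, s.left ∪ Γ, s.right ∪ Δ⟩) :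
    Sequent.Good Fr ⟨s.rel ∪ G, s.left ∪ Γ, s.right ∪ Δ⟩ M :=
  ⟨(h.below.mono hNM).union hG hΓ hΔ, hd⟩

theorem Sequent.Good.left {s : Sequent P} {N M : ℕ} (h : s.Good Fr N) (hNM : N ≤ M)
    {Γ : Set (LFormula P)} (hΓ : ∀ c ∈ Γ, c.1 < M)
    (hd : ¬ Derivable Fr ⟨s.rel, s.left ∪ Γ, s.right⟩) :
    Sequent.Good Fr ⟨s.rel, s.left ∪ Γ, s.right⟩ M := by
  simpa using h.union hNM (G := ∅) (Δ := ∅) (by simp) hΓ (by simp) (by simpa using hd)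

theorem Sequent.Good.right {s : Sequent P} {N M : ℕ} (h : s.Good Fr N) (hNM : N ≤ M)
    {Δ : Set (LFormula P)} (hΔ : ∀ c ∈ Δ, c.1 < M)
    (hd : ¬ Derivable Fr ⟨s.rel, s.left, s.right ∪ Δ⟩) :
    Sequent.Good Fr ⟨s.rel, s.left, s.right ∪ Δ⟩ M := by
  simpa using h.union hNM (G := ∅) (Γ := ∅) (by simp) (by simp) hΔ (by simpa using hd)

theorem Sequent.Good.rel {s : Sequent P} {N M : ℕ} (h : s.Good Fr N) (hNM : N ≤ M)
    {G : Set (RelAtom Label)} (hG : ∀ r ∈ G, ∀ a ∈ r.args, a < M)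
    (hd : ¬ Derivable Fr ⟨s.rel ∪ G, s.left, s.right⟩) :
    Sequent.Good Fr ⟨s.rel ∪ G, s.left, s.right⟩ M := by
  simpa using h.union hNM (Γ := ∅) (Δ := ∅) hG (by simp) (by simp) (by simpa using hd)

/-- The new sequent is a premise of the left rule for `C`, with the principal formula retained. The
bound grows by one block, which contains the two fresh labels that `starL` may introduce since `2 ≤
alpha Fr`. -/
theorem good_stepLeft {i : ℕ} (hi : 1 ≤ i) {m : Label} {C : Formula P}
    {R : Finset (RelAtom Label)} {s : Sequent P} (h : s.Good Fr (alpha Fr * i))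
    (hC : (m, C) ∈ s.left) : (stepLeft Fr i m C R s).Good Fr (alpha Fr * i + alpha Fr) := by
  have hα := two_le_alpha Fr
  have hpos : alpha Fr ≤ alpha Fr * i := Nat.le_mul_of_pos_right _ hi
  have hm : m < alpha Fr * i := h.below.left _ hC
  have hle : alpha Fr * i ≤ alpha Fr * i + alpha Fr := Nat.le_add_right _ _
  have hd := h.underivable
  rcases s with ⟨G, Γ, Δ⟩
  simp only at hC hd
  rw [← Set.insert_eq_of_mem hC] at hd
  generalize hN : alpha Fr * i = N at *
  cases C with
  | var p => exact h.mono hle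
  | top => exact h.mono hle
  | bot => exact h.mono hle
  | emp =>
    refine h.rel hle ?_ fun hd' => hd (.empL ?_)
    · rintro r rfl a ha
      simp only [RelAtom.args, eps, Set.mem_insert_iff, Set.mem_singleton_iff] at ha
      lia
    · simpa using hd'
  | and A B =>
    refine h.left hle ?_ fun hd' => hd (.andL ?_)
    · rintro c (rfl | rfl) <;> exact hm.trans_le hle
    · simpa [Set.union_insert, Set.insert_eq_of_mem hC] using hd'
  | imp A B =>
    simp only [stepLeft]
    -- In the first case the premise with `A` on the right is derivable, so the one with `B` on the
    -- left is not. In the second case the premise with `A` is itself underivable.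
    split_ifs with hA
    · refine h.left hle ?_ fun hd' => hd (.impL hA (by simpa using hd'))
      rintro c rfl
      exact hm.trans_le hle
    · refine h.right hle ?_ (by simpa using hA)
      rintro c rfl
      exact hm.trans_le hle
  | star A B =>
    simp only [stepLeft, hN]
    have := h.union hle (G := {.tern N (N + 1) m})
      (Γ := {(N, A), (N + 1, B)}) (Δ := ∅) ?_ ?_ (by simp) ?_
    · simpa using this
    · rintro r rfl a ha
      simp only [RelAtom.args, Set.mem_insert_iff, Set.mem_singleton_iff] at ha
      lia
    · rintro c (rfl | rfl)
      · exact Nat.lt_add_of_pos_right (by lia)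
      · exact Nat.add_lt_add_left (by lia) N
    · intro hd'
      refine hd (.starL (x := N) (y := N + 1)
        (by lia) (by simp only [eps, ne_eq]; lia) (by simp only [eps, ne_eq]; lia) ?_ ?_ ?_)
      · rw [Set.insert_eq_of_mem hC]
        exact h.below.notMem_labels le_rfl
      · rw [Set.insert_eq_of_mem hC]
        exact h.below.notMem_labels (Nat.le_succ _)
      · simpa [Set.union_insert] using hd'
  | wand A B =>
    simp only [stepLeft]
    split
    · next x m' y _ =>
      split_ifs with hx hA
      · refine h.left hle ?_ fun hd' => hd ?_
        · rintro c rfl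
          exact (h.below.rel _ hx.1 y (by simp [RelAtom.args])).trans_le hle
        · rw [← Set.insert_eq_of_mem hx.1]
          refine .wandL hx.2.symm ?_ ?_
          · rw [Set.insert_eq_of_mem hx.1, Set.insert_eq_of_mem hC]
            exact hA
          · rw [Set.insert_eq_of_mem hx.1, Set.insert_eq_of_mem hC]
            simpa using hd'
      · refine h.right hle ?_ (by simpa using hA)
        rintro c rfl
        exact (h.below.rel _ hx.1 x (by simp [RelAtom.args])).trans_le hle
      · exact h.mono hle
    · exact h.mono hle

/-- Dual to `good_stepLeft`: here `wandR` uses the two fresh labels, and `andR` and `starR` are the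
branching rules. -/
theorem good_stepRight {i : ℕ} (hi : 1 ≤ i) {m : Label} {C : Formula P}
    {R : Finset (RelAtom Label)} {s : Sequent P} (h : s.Good Fr (alpha Fr * i))
    (hC : (m, C) ∈ s.right) : (stepRight Fr i m C R s).Good Fr (alpha Fr * i + alpha Fr) := by
  have hα := two_le_alpha Fr
  have hpos : alpha Fr ≤ alpha Fr * i := Nat.le_mul_of_pos_right _ hi
  have hm : m < alpha Fr * i := h.below.right _ hC
  have hle : alpha Fr * i ≤ alpha Fr * i + alpha Fr := Nat.le_add_right _ _
  have hd := h.underivable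
  rcases s with ⟨G, Γ, Δ⟩
  simp only at hC hd
  rw [← Set.insert_eq_of_mem hC] at hd
  generalize hN : alpha Fr * i = N at *
  cases C with
  | var p => exact h.mono hle
  | top => exact h.mono hle
  | bot => exact h.mono hle
  | emp => exact h.mono hle
  | and A B =>
    simp only [stepRight]
    split_ifs with hA
    · refine h.right hle ?_ fun hd' => hd (.andR hA (by simpa using hd'))
      rintro c rfl
      exact hm.trans_le hle
    · refine h.right hle ?_ (by simpa using hA)
      rintro c rfl
      exact hm.trans_le hle
  | imp A B =>
    simp only [stepRight]
    have := h.union hle (G := ∅) (Γ := {(m, A)}) (Δ := {(m, B)}) (by simp) ?_ ?_ ?_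
    · simpa using this
    · rintro c rfl
      exact hm.trans_le hle
    · rintro c rfl
      exact hm.trans_le hle
    · exact fun hd' => hd (.impR (by simpa using hd'))
  | wand A B =>
    simp only [stepRight, hN]
    have := h.union hle (G := {.tern N m (N + 1)})
      (Γ := {(N, A)}) (Δ := {(N + 1, B)}) ?_ ?_ ?_ ?_
    · simpa using this
    · rintro r rfl a ha
      simp only [RelAtom.args, Set.mem_insert_iff, Set.mem_singleton_iff] at ha
      lia
    · rintro c rfl
      exact Nat.lt_add_of_pos_right (by lia)
    · rintro c rfl
      exact Nat.add_lt_add_left (by lia) N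
    · intro hd'
      refine hd (.wandR (x := N) (y := N + 1)
        (by lia) (by simp only [eps, ne_eq]; lia) (by simp only [eps, ne_eq]; lia) ?_ ?_ ?_)
      · rw [Set.insert_eq_of_mem hC]
        exact h.below.notMem_labels le_rfl
      · rw [Set.insert_eq_of_mem hC]
        exact h.below.notMem_labels (Nat.le_succ _)
      · simpa using hd'
  | star A B =>
    simp only [stepRight]
    split
    · next x y m' _ =>
      split_ifs with hx hA
      · refine h.right hle ?_ fun hd' => hd ?_
        · rintro c rfl
          exact (h.below.rel _ hx.1 y (by simp [RelAtom.args])).trans_le hle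
        · rw [← Set.insert_eq_of_mem hx.1]
          refine .starR hx.2 ?_ ?_
          · rw [Set.insert_eq_of_mem hx.1, Set.insert_eq_of_mem hC]
            exact hA
          · rw [Set.insert_eq_of_mem hx.1, Set.insert_eq_of_mem hC]
            simpa using hd'
      · refine h.right hle ?_ (by simpa using hA)
        rintro c rfl
        exact (h.below.rel _ hx.1 x (by simp [RelAtom.args])).trans_le hle
      · exact h.mono hle
    · exact h.mono hle

theorem good_step {i : ℕ} (hi : 1 ≤ i) (S : Schedule P Fr) {s : Sequent P}
    (h : s.Good Fr (alpha Fr * i)) : (step i S s).Good Fr (alpha Fr * i + alpha Fr) := by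
  have hα := two_le_alpha Fr
  have hpos : alpha Fr ≤ alpha Fr * i := Nat.le_mul_of_pos_right _ hi
  have hle : alpha Fr * i ≤ alpha Fr * i + alpha Fr := Nat.le_add_right _ _
  unfold step
  split
  · split
    · split_ifs with hC
      exacts [good_stepLeft hi h hC, h.mono hle]
    · split_ifs with hC
      exacts [good_stepRight hi h hC, h.mono hle]
  · split
    · next w w' _ _ =>
      split_ifs with hw hd
      · refine h.rel hle ?_ fun hd' =>
          h.underivable (.em w w' hd (by simpa using hd'))
        rintro r rfl a (rfl | rfl)
        exacts [hw.1, hw.2]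
      · refine h.rel hle ?_ (by simpa using hd)
        rintro r rfl a (rfl | rfl)
        exacts [hw.1, hw.2]
      · exact h.mono hle
    · exact h.mono hle
  · next j θ _ =>
    split_ifs with hc
    · obtain ⟨-, hsub, heqs, hθ⟩ := hc
      -- The atoms `Sᵢθ` are already present, so `s` has the shape of a conclusion of the structural
      -- rule.
      have hG : s.rel ∪ (Fr j).hypsInst θ = s.rel := Set.union_eq_left.2 hsub
      refine h.rel hle (FrameAxiom.lt_of_mem_conclsInst (by lia)
        (fun u => (hθ u).trans_le hle) fun v => ?_) fun hd => h.underivable ?_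
      · have := v.2.trans_le (arity_le_alpha Fr j)
        lia
      · have hs : s = ⟨s.rel ∪ (Fr j).hypsInst θ, s.left, s.right⟩ := by rw [hG]
        rw [hs]
        refine .structural j θ (fun v => alpha Fr * i + v) heqs ?_ ?_ (by rwa [hG])
        · exact fun v v' hv => Fin.ext (Nat.add_left_cancel hv)
        · intro v
          refine ⟨by simp only [eps, ne_eq]; lia, ?_, ?_⟩
          -- The labels `θ u` need not occur in `s`, so the bound on `s` says nothing about them;
          -- the guard `θ u < alpha Fr * i` of the construction does.
          · rintro ⟨u, hu⟩
            have := hθ u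
            lia
          · rw [← hs]
            exact h.below.notMem_labels (Nat.le_add_right _ _)
    · exact h.mono hle

/-! ### The series of sequents and its limit -/

variable {φ : ℕ → Schedule P Fr} {F : Formula P}

/-- The invariant of the construction. The factor is `n + 1` because `stage φ F n` has index `n +
1`, so the bound is exactly where the block used by the next step begins. -/
theorem good_stage (hF : Unprovable Fr F) (n : ℕ) :
    (stage φ F n).Good Fr (alpha Fr * (n + 1)) := by
  induction n with
  | zero =>
    refine ⟨⟨by simp [stage], by simp [stage], ?_⟩, hF 1 one_ne_zero⟩
    rintro c rfl
    have := two_le_alpha Fr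
    -- The initial label `a₁` lies below the first reserved block because `2 ≤ alpha Fr`.
    change 1 < alpha Fr * (0 + 1)
    lia
  | succ n ih => exact good_step (Nat.le_add_left 1 n) _ ih

theorem stage_sub {n n' : ℕ} (h : n ≤ n') : (stage φ F n).Sub (stage φ F n') := by
  induction n', h using Nat.le_induction with
  | base => exact .refl _
  | succ k _ ih => exact ih.trans (sub_step _ _ _)

theorem stage_sub_limitSequent (n : ℕ) : (stage φ F n).Sub (limitSequent φ F) :=
  ⟨Set.subset_iUnion (fun n => (stage φ F n).rel) n,
    Set.subset_iUnion (fun n => (stage φ F n).left) n,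
    Set.subset_iUnion (fun n => (stage φ F n).right) n⟩

/-! ### Facts about the limit hold at all late stages -/

open Filter in
theorem eventually_left {c : LFormula P} (h : c ∈ (limitSequent φ F).left) :
    ∀ᶠ n in atTop, c ∈ (stage φ F n).left := by
  obtain ⟨n, hn⟩ := Set.mem_iUnion.1 h
  exact eventually_atTop.2 ⟨n, fun k hk => (stage_sub hk).left hn⟩

open Filter in
theorem eventually_right {c : LFormula P} (h : c ∈ (limitSequent φ F).right) :
    ∀ᶠ n in atTop, c ∈ (stage φ F n).right := by
  obtain ⟨n, hn⟩ := Set.mem_iUnion.1 h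
  exact eventually_atTop.2 ⟨n, fun k hk => (stage_sub hk).right hn⟩

open Filter in
theorem eventually_rel {r : RelAtom Label} (h : r ∈ (limitSequent φ F).rel) :
    ∀ᶠ n in atTop, r ∈ (stage φ F n).rel := by
  obtain ⟨n, hn⟩ := Set.mem_iUnion.1 h
  exact eventually_atTop.2 ⟨n, fun k hk => (stage_sub hk).rel hn⟩

open Filter in
theorem eventually_subset_rel {G : Set (RelAtom Label)} (hG : G.Finite)
    (h : G ⊆ (limitSequent φ F).rel) : ∀ᶠ n in atTop, G ⊆ (stage φ F n).rel :=
  (eventually_all_finite hG).2 fun _ hr => eventually_rel (h hr)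

open Filter in
theorem eventually_eqJudg {x y : Label} (h : EqMod (limitSequent φ F).rel x y) :
    ∀ᶠ n in atTop, EqJudg (stage φ F n).rel x y := by
  obtain ⟨G, hs, hf, e⟩ := h
  filter_upwards [eventually_subset_rel hf hs] with n hn using e.mono hn

open Filter in
/-- A fair scheduler meets every schedule at a stage with a given eventual property. -/
theorem Fair.exists_step (hφ : Fair φ) (S : Schedule P Fr) {p : ℕ → Prop}
    (hp : ∀ᶠ n in atTop, p n) :
    ∃ n, p n ∧ (step (n + 1) S (stage φ F n)).Sub (limitSequent φ F) := by
  obtain ⟨N, hN⟩ := eventually_atTop.1 hp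
  -- Strict inequality serves twice: it makes `i` positive, as `φ 0` is never consulted, and it
  -- gives `N ≤ i - 1`, the stage to which step `i` is applied.
  obtain ⟨i, hi, hNi⟩ := (hφ S).exists_gt N
  obtain ⟨n, rfl⟩ : ∃ n, i = n + 1 := ⟨i - 1, by lia⟩
  refine ⟨n, hN n (by lia), ?_⟩
  have := stage_sub_limitSequent (φ := φ) (F := F) (n + 1)
  rwa [stage, show φ (n + 1) = S from hi] at this

/-- The schedule with a single relational atom. -/
def Schedule.ofAtom (Fr : Fin q → FrameAxiom) (o : Side) (m : Label) (C : ExFormula P Fr)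
    (r : RelAtom Label) : Schedule P Fr :=
  ⟨o, m, C, {r}, by simp⟩

theorem theTern_singleton (x y z : Label) : theTern {RelAtom.tern x y z} = some (x, y, z) :=
  (theTern_eq_some _ _ _ _).2 rfl

/-- Ensures that the instantiated hypotheses fit within the size limit of a schedule; distinct
hypotheses may collapse under `θ`, hence only an inequality. -/
theorem FrameAxiom.exists_finset_hypsInst_eq (ax : FrameAxiom) (θ : Fin ax.m → Label) :
    ∃ R : Finset (RelAtom Label), ax.hypsInst θ = ↑R ∧ R.card ≤ ax.hyps.length := by
  classical
  refine ⟨(ax.hyps.map (RelAtom.map (LTerm.inst θ))).toFinset, ?_, ?_⟩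
  · ext r
    simp [FrameAxiom.hypsInst, eq_comm]
  · exact (List.toFinset_card_le _).trans (by simp)

/-! ### The Hintikka conditions -/

open Filter in
theorem limitSequent_isHintikka (hφ : Fair φ) (hF : Unprovable Fr F) :
    IsHintikka Fr (limitSequent φ F) where
  c1 := by
    rintro A a b ⟨ha, hb, e⟩
    obtain ⟨n, ha, hb, e⟩ :=
      ((eventually_left ha).and ((eventually_right hb).and (eventually_eqJudg e))).exists
    have h := good_stage (φ := φ) hF n
    -- The rule `id` covers only propositional variables, whereas this condition concerns every
    -- formula.
    exact h.underivable (derivable_identity A _ _ _ a b _ h.below ha hb e)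
  c2 := by
    refine fun a => ⟨fun ha => ?_, fun ha => ?_⟩
    · obtain ⟨n, ha⟩ := (eventually_left ha).exists
      refine (good_stage (φ := φ) hF n).underivable ?_
      have := Derivable.botL (Fr := Fr) (G := (stage φ F n).rel) (Γ := (stage φ F n).left)
        (Δ := (stage φ F n).right) (w := a)
      rwa [Set.insert_eq_of_mem ha] at this
    · obtain ⟨n, ha⟩ := (eventually_right ha).exists
      refine (good_stage (φ := φ) hF n).underivable ?_
      have := Derivable.topR (Fr := Fr) (G := (stage φ F n).rel) (Γ := (stage φ F n).left)
        (Δ := (stage φ F n).right) (w := a)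
      rwa [Set.insert_eq_of_mem ha] at this
  c3 := by
    intro a ha
    obtain ⟨n, hn, hsub⟩ := hφ.exists_step (F := F)
      -- The atom is a dummy: this step ignores it. The same filler is used below wherever the atoms
      -- play no role.
      (.ofAtom Fr .left a (.fml .emp) (.tern 0 0 0)) (eventually_left ha)
    simp only [step, Schedule.ofAtom, hn, ↓reduceIte, stepLeft] at hsub
    exact (EqJudg.hyp (hsub.rel (.inr rfl))).eqMod
  c4 := by
    intro a ha e
    obtain ⟨n, ha, e⟩ := ((eventually_right ha).and (eventually_eqJudg e)).exists
    refine (good_stage (φ := φ) hF n).underivable ?_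
    have := Derivable.empR (Fr := Fr) (Γ := (stage φ F n).left) (Δ := (stage φ F n).right) e
    rwa [Set.insert_eq_of_mem ha] at this
  c5 := by
    intro A B a ha
    obtain ⟨n, hn, hsub⟩ := hφ.exists_step (F := F)
      (.ofAtom Fr .left a (.fml (.and A B)) (.tern 0 0 0)) (eventually_left ha)
    simp only [step, Schedule.ofAtom, hn, ↓reduceIte, stepLeft] at hsub
    exact ⟨hsub.left (.inr (.inl rfl)), hsub.left (.inr (.inr rfl))⟩
  c6 := by
    intro A B a ha
    obtain ⟨n, hn, hsub⟩ := hφ.exists_step (F := F)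
      (.ofAtom Fr .right a (.fml (.and A B)) (.tern 0 0 0)) (eventually_right ha)
    simp only [step, Schedule.ofAtom, hn, ↓reduceIte] at hsub
    simp only [stepRight] at hsub
    split at hsub
    · exact .inl (hsub.right (.inr rfl))
    · exact .inr (hsub.right (.inr rfl))
  c7 := by
    intro A B a ha
    obtain ⟨n, hn, hsub⟩ := hφ.exists_step (F := F)
      (.ofAtom Fr .left a (.fml (.imp A B)) (.tern 0 0 0)) (eventually_left ha)
    simp only [step, Schedule.ofAtom, hn, ↓reduceIte] at hsub
    simp only [stepLeft] at hsub
    split at hsub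
    · exact .inl (hsub.right (.inr rfl))
    · exact .inr (hsub.left (.inr rfl))
  c8 := by
    intro A B a ha
    obtain ⟨n, hn, hsub⟩ := hφ.exists_step (F := F)
      (.ofAtom Fr .right a (.fml (.imp A B)) (.tern 0 0 0)) (eventually_right ha)
    simp only [step, Schedule.ofAtom, hn, ↓reduceIte, stepRight] at hsub
    exact ⟨hsub.left (.inr rfl), hsub.right (.inr rfl)⟩
  c9 := by
    intro A B z hz
    obtain ⟨n, hn, hsub⟩ := hφ.exists_step (F := F)
      (.ofAtom Fr .left z (.fml (.star A B)) (.tern 0 0 0)) (eventually_left hz)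
    simp only [step, Schedule.ofAtom, hn, ↓reduceIte, stepLeft] at hsub
    -- The witnesses are the two fresh labels of the step, and the new atom ends in `z` itself, so
    -- reflexivity suffices.
    exact ⟨_, _, z, hsub.rel (.inr rfl), (EqJudg.refl z).eqMod, hsub.left (.inr (.inl rfl)),
      hsub.left (.inr (.inr rfl))⟩
  c10 := by
    intro A B z hz x y z' hr e
    obtain ⟨n, ⟨hn, hr, e⟩, hsub⟩ := hφ.exists_step (F := F)
      (.ofAtom Fr .right z (.fml (.star A B)) (.tern x y z'))
      ((eventually_right hz).and ((eventually_rel hr).and (eventually_eqJudg e)))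
    simp only [step, Schedule.ofAtom, hn, ↓reduceIte, stepRight, theTern_singleton,
      hr, e, and_self] at hsub
    split at hsub
    · exact .inl (hsub.right (.inr rfl))
    · exact .inr (hsub.right (.inr rfl))
  c11 := by
    intro A B z hz x y z' hr e
    obtain ⟨n, ⟨hn, hr, e⟩, hsub⟩ := hφ.exists_step (F := F)
      (.ofAtom Fr .left z (.fml (.wand A B)) (.tern x z' y))
      ((eventually_left hz).and ((eventually_rel hr).and (eventually_eqJudg e)))
    simp only [step, Schedule.ofAtom, hn, ↓reduceIte, stepLeft, theTern_singleton,
      hr, e.symm, and_self] at hsub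
    split at hsub
    · exact .inl (hsub.right (.inr rfl))
    · exact .inr (hsub.left (.inr rfl))
  c12 := by
    intro A B z hz
    obtain ⟨n, hn, hsub⟩ := hφ.exists_step (F := F)
      (.ofAtom Fr .right z (.fml (.wand A B)) (.tern 0 0 0)) (eventually_right hz)
    simp only [step, Schedule.ofAtom, hn, ↓reduceIte, stepRight] at hsub
    exact ⟨_, _, z, hsub.rel (.inr rfl), (EqJudg.refl z).eqMod, hsub.left (.inr rfl),
      hsub.right (.inr rfl)⟩
  c13 := by
    rintro a b ⟨hr, e⟩
    obtain ⟨n, hr, e⟩ := ((eventually_rel hr).and (eventually_eqJudg e)).exists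
    refine (good_stage (φ := φ) hF n).underivable ?_
    have := Derivable.nEq (Fr := Fr) (Γ := (stage φ F n).left) (Δ := (stage φ F n).right) e
    rwa [Set.insert_eq_of_mem hr] at this
  c14 := by
    intro a b
    -- Waiting until `n` exceeds both labels meets the range guard of the `EM` step. The third
    -- argument of the atom is irrelevant.
    obtain ⟨n, hn, hsub⟩ := hφ.exists_step (F := F) (.ofAtom Fr .left 0 .em (.tern a b 0))
      (eventually_ge_atTop (max a b))
    have hn' : n + 1 ≤ alpha Fr * (n + 1) :=
      Nat.le_mul_of_pos_left _ (by have := two_le_alpha Fr; lia)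
    have hab : a < alpha Fr * (n + 1) + alpha Fr ∧ b < alpha Fr * (n + 1) + alpha Fr := by
      have := max_le_iff.1 hn
      lia
    simp only [step, Schedule.ofAtom, theTern_singleton, hab, and_self, ↓reduceIte] at hsub
    split at hsub
    · exact .inr (EqJudg.hyp (hsub.rel (.inr rfl))).eqMod
    · exact .inl (hsub.rel (.inr rfl))
  c15 := by
    intro j θ hsub heqs
    obtain ⟨R, hR, hcard⟩ := (Fr j).exists_finset_hypsInst_eq θ
    have hev : ∀ᶠ n in atTop, (Fr j).EqsHold (stage φ F n).rel θ :=
      (eventually_all_finite (List.finite_toSet (Fr j).eqs)).2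
        fun e he => eventually_eqJudg (heqs e he)
    -- The axiom has finitely many universal variables, hypotheses and equations, so a single late
    -- stage meets all guards of the structural step.
    obtain ⟨n, ⟨hn, hG, hE⟩, hlim⟩ := hφ.exists_step (F := F)
      ⟨.left, 0, .gs j θ, R,
        hcard.trans ((length_le_kMax Fr j).trans (le_max_right _ _))⟩
      ((eventually_all.2 fun u => eventually_ge_atTop (θ u)).and
        ((eventually_subset_rel (hR ▸ R.finite_toSet) hsub).and hev))
    have hn' : n + 1 ≤ alpha Fr * (n + 1) :=
      Nat.le_mul_of_pos_left _ (by have := two_le_alpha Fr; lia)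
    have hc : (Fr j).hypsInst θ = ↑R ∧ (Fr j).hypsInst θ ⊆ (stage φ F n).rel ∧
        (Fr j).EqsHold (stage φ F n).rel θ ∧ ∀ u, θ u < alpha Fr * (n + 1) :=
      ⟨hR, hG, hE, fun u => by have := hn u; lia⟩
    simp only [step, if_pos hc] at hlim
    -- The witness for the existential variables is the block of labels reserved for this step.
    exact ⟨_, Set.subset_union_right.trans hlim.rel⟩

end

end SepLogic

theorem mainTheorem4 {P : Type*} {q : ℕ} (Fr : Fin q → SepLogic.FrameAxiom)
    (φ : ℕ → SepLogic.Schedule P Fr) (hφ : SepLogic.Fair φ)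
    (F : SepLogic.Formula P) (hF : SepLogic.Unprovable Fr F) :
    SepLogic.IsHintikka Fr (SepLogic.limitSequent φ F) :=
  SepLogic.limitSequent_isHintikka hφ hF
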